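/- Let $n\ge 1$, $T>0$, and let $\alpha:\mathbb R^n\to\mathbb R$ be bounded. For a locally bounded function $f$ write $f^*(a)=\lim_{r\to0^+}\sup_{B(a,r)}f$ and $f_*(a)=\lim_{r\to0^+}\inf_{B(a,r)}f$ for its upper and lower semicontinuous envelopes; $B(x,r]$ is the closed ball and $D$ is the gradient in $x$. A locally bounded function $u$ on $\mathbb R^n\times(0,T)$ is a *viscosity supersolution* (resp. *subsolution*) of $u_t+\alpha(x)|Du|=0$ in $\mathbb R^n\times(0,T)$ if for every $\varphi\in C^1(\mathbb R^n\times(0,T))$ and every local minimum point $(x,t)$ of $u_*-\varphi$ (resp. local maximum point of $u^*-\varphi$) one has $\varphi_t(x,t)+\alpha^*(x)|D\varphi(x,t)|\ge0$ (resp. $\varphi_t(x,t)+\alpha_*(x)|D\varphi(x,t)|\le0$). A family $(\Omega_t)_{t\in(0,T)}$ of open (resp. $(\mathcal F_t)_{t\in(0,T)}$ of closed) subsets of $\mathbb R^n$ is a *generalized superflow* (resp. *subflow*) with normal velocity $-\alpha$ if for all $x_0\in\mathbb R^n$, $t\in(0,T)$, $r>0$, $h>0$ with $t+h<T$ and every $C^\infty$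 function $\phi:\mathbb R^n\times[0,T]\to\mathbb R$ such that 1. $\phi_t(x,s)+\alpha^*(x)|D\phi(x,s)|<0$ (resp. $\phi_t(x,s)+\alpha_*(x)|D\phi(x,s)|>0$) for all $(x,s)\in B(x_0,r]\times[t,t+h]$; 2. for every $s\in[t,t+h]$ the set $\{x\in B(x_0,r]:\phi(x,s)=0\}$ is non-empty, and $D\phi(x,s)\ne0$ at all $(x,s)\in B(x_0,r]\times[t,t+h]$ with $\phi(x,s)=0$; 3. $\{x\in B(x_0,r]:\phi(x,t)\ge0\}\subset\Omega_t$ (resp. $\{x\in B(x_0,r]:\phi(x,t)\le0\}\subset\mathcal F_t^c$); 4. $\{x\in\partial B(x_0,r]:\phi(x,s)\ge0\}\subset\Omega_s$ (resp. $\{x\in\partial B(x_0,r]:\phi(x,s)\le0\}\subset\mathcal F_s^c$) for all $s\in[t,t+h]$; one has $\{x\in B(x_0,r]:\phi(x,s)>0\}\subset\Omega_s$ (resp. $\{x\in B(x_0,r]:\phi(x,s)<0\}\subset\mathcal F_s^c$) for every $s\in(t,t+h)$. **Theorem.** (i) Let $(\Omega_t)_{t\in(0,T)}$ be a family of open subsets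 of $\mathbb R^n$ such that $\Omega=\bigcup_{t\in(0,T)}\Omega_t\times\{t\}$ is open in $\mathbb R^n\times(0,T)$. Then $(\Omega_t)_{t\in(0,T)}$ is a generalized superflow with normal velocity $-\alpha$ if and only if $\chi=\mathbf 1_\Omega-\mathbf 1_{\Omega^c}$ is a viscosity supersolution of $u_t+\alpha(x)|Du|=0$ in $\mathbb R^n\times(0,T)$. (ii) Let $(\mathcal F_t)_{t\in(0,T)}$ be a family of closed subsets of $\mathbb R^n$ such that $\mathcal F=\bigcup_{t\in(0,T)}\mathcal F_t\times\{t\}$ is (relatively) closed in $\mathbb R^n\times(0,T)$. Then $(\mathcal F_t)_{t\in(0,T)}$ is a generalized subflow with normal velocity $-\alpha$ if and only if $\overline\chi=\mathbf 1_{\mathcal F}-\mathbf 1_{\mathcal F^c}$ is a viscosity subsolution of $u_t+\alpha(x)|Du|=0$ in $\mathbb R^n\times(0,T)$. -/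

import Mathlib

open Set Filter Topology
open scoped ContDiff

noncomputable section

/-- The upper semicontinuous envelope `f^*(a) = lim_{r → 0+} sup_{B(a,r)} f` of a locally bounded
real function (the neighbourhoods of `a` contain `a` itself). -/
def uscEnvelope {X : Type*} [TopologicalSpace X] (f : X → ℝ) (a : X) : ℝ :=
  limsup f (𝓝 a)

/-- The lower semicontinuous envelope `f_*(a) = lim_{r → 0+} inf_{B(a,r)} f` of a locally bounded
real function. -/
def lscEnvelope {X : Type*} [TopologicalSpace X] (f : X → ℝ) (a : X) : ℝ :=
  liminf f (𝓝 a)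

/-- The open strip `ℝⁿ × (0,T)` in space-time. -/
def openStrip (n : ℕ) (T : ℝ) : Set (EuclideanSpace ℝ (Fin n) × ℝ) :=
  univ ×ˢ Ioo 0 T

/-- The partial derivative `∂φ/∂t` at `(x,t)`. -/
def timeDeriv {n : ℕ} (φ : EuclideanSpace ℝ (Fin n) × ℝ → ℝ)
    (x : EuclideanSpace ℝ (Fin n)) (t : ℝ) : ℝ :=
  deriv (fun s => φ (x, s)) t

/-- The spatial gradient `Dφ` at `(x,t)`. -/
def spaceGrad {n : ℕ} (φ : EuclideanSpace ℝ (Fin n) × ℝ → ℝ)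
    (x : EuclideanSpace ℝ (Fin n)) (t : ℝ) : EuclideanSpace ℝ (Fin n) :=
  gradient (fun y => φ (y, t)) x

/-- `u` is bounded in a neighbourhood of every point of `S`. -/
def LocallyBoundedOn {X : Type*} [TopologicalSpace X] (u : X → ℝ) (S : Set X) : Prop :=
  ∀ p ∈ S, ∃ C : ℝ, ∀ᶠ q in 𝓝 p, |u q| ≤ C

/-- `u` is a (discontinuous) viscosity supersolution of `u_t + α(x)|Du| = 0` in `ℝⁿ × (0,T)`, in
the sense of Ishii: `u_t + α^*(x)|Du| ≥ 0` is tested where `u_* - φ` has a local minimum.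
Only the values of `u` on the open strip matter. -/
def IsViscositySupersolution {n : ℕ} (α : EuclideanSpace ℝ (Fin n) → ℝ) (T : ℝ)
    (u : EuclideanSpace ℝ (Fin n) × ℝ → ℝ) : Prop :=
  LocallyBoundedOn u (openStrip n T) ∧
  ∀ φ : EuclideanSpace ℝ (Fin n) × ℝ → ℝ, ContDiffOn ℝ 1 φ (openStrip n T) →
    ∀ (x : EuclideanSpace ℝ (Fin n)) (t : ℝ), t ∈ Ioo 0 T →
      IsLocalMin (fun p => lscEnvelope u p - φ p) (x, t) →
        0 ≤ timeDeriv φ x t + uscEnvelope α x * ‖spaceGrad φ x t‖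

/-- `u` is a (discontinuous) viscosity subsolution of `u_t + α(x)|Du| = 0` in `ℝⁿ × (0,T)`, in
the sense of Ishii: `u_t + α_*(x)|Du| ≤ 0` is tested where `u^* - φ` has a local maximum. -/
def IsViscositySubsolution {n : ℕ} (α : EuclideanSpace ℝ (Fin n) → ℝ) (T : ℝ)
    (u : EuclideanSpace ℝ (Fin n) × ℝ → ℝ) : Prop :=
  LocallyBoundedOn u (openStrip n T) ∧
  ∀ φ : EuclideanSpace ℝ (Fin n) × ℝ → ℝ, ContDiffOn ℝ 1 φ (openStrip n T) →
    ∀ (x : EuclideanSpace ℝ (Fin n)) (t : ℝ), t ∈ Ioo 0 T →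
      IsLocalMax (fun p => uscEnvelope u p - φ p) (x, t) →
        timeDeriv φ x t + lscEnvelope α x * ‖spaceGrad φ x t‖ ≤ 0

/-- The family `(Ω_t)`, `t ∈ (0,T)`, of open sets is a generalized superflow with normal velocity
`-α`. The test functions `φ` are smooth on `ℝⁿ × [0,T]`. -/
def IsGeneralizedSuperflow {n : ℕ} (α : EuclideanSpace ℝ (Fin n) → ℝ) (T : ℝ)
    (Ω : ℝ → Set (EuclideanSpace ℝ (Fin n))) : Prop :=
  (∀ t ∈ Ioo 0 T, IsOpen (Ω t)) ∧
  ∀ (x₀ : EuclideanSpace ℝ (Fin n)) (t r h : ℝ), t ∈ Ioo 0 T → 0 < r → 0 < h → t + h < T →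
    ∀ φ : EuclideanSpace ℝ (Fin n) × ℝ → ℝ, ContDiffOn ℝ ∞ φ (univ ×ˢ Icc 0 T) →
      (∀ x ∈ Metric.closedBall x₀ r, ∀ s ∈ Icc t (t + h),
        timeDeriv φ x s + uscEnvelope α x * ‖spaceGrad φ x s‖ < 0) →
      (∀ s ∈ Icc t (t + h), ∃ x ∈ Metric.closedBall x₀ r, φ (x, s) = 0) →
      (∀ x ∈ Metric.closedBall x₀ r, ∀ s ∈ Icc t (t + h),
        φ (x, s) = 0 → ‖spaceGrad φ x s‖ ≠ 0) →
      {x ∈ Metric.closedBall x₀ r | 0 ≤ φ (x, t)} ⊆ Ω t →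
      (∀ s ∈ Icc t (t + h), {x ∈ Metric.sphere x₀ r | 0 ≤ φ (x, s)} ⊆ Ω s) →
      ∀ s ∈ Ioo t (t + h), {x ∈ Metric.closedBall x₀ r | 0 < φ (x, s)} ⊆ Ω s

/-- The family `(F_t)`, `t ∈ (0,T)`, of closed sets is a generalized subflow with normal velocity
`-α`. The test functions `φ` are smooth on `ℝⁿ × [0,T]`. -/
def IsGeneralizedSubflow {n : ℕ} (α : EuclideanSpace ℝ (Fin n) → ℝ) (T : ℝ)
    (F : ℝ → Set (EuclideanSpace ℝ (Fin n))) : Prop :=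
  (∀ t ∈ Ioo 0 T, IsClosed (F t)) ∧
  ∀ (x₀ : EuclideanSpace ℝ (Fin n)) (t r h : ℝ), t ∈ Ioo 0 T → 0 < r → 0 < h → t + h < T →
    ∀ φ : EuclideanSpace ℝ (Fin n) × ℝ → ℝ, ContDiffOn ℝ ∞ φ (univ ×ˢ Icc 0 T) →
      (∀ x ∈ Metric.closedBall x₀ r, ∀ s ∈ Icc t (t + h),
        0 < timeDeriv φ x s + lscEnvelope α x * ‖spaceGrad φ x s‖) →
      (∀ s ∈ Icc t (t + h), ∃ x ∈ Metric.closedBall x₀ r, φ (x, s) = 0) →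
      (∀ x ∈ Metric.closedBall x₀ r, ∀ s ∈ Icc t (t + h),
        φ (x, s) = 0 → ‖spaceGrad φ x s‖ ≠ 0) →
      {x ∈ Metric.closedBall x₀ r | φ (x, t) ≤ 0} ⊆ (F t)ᶜ →
      (∀ s ∈ Icc t (t + h), {x ∈ Metric.sphere x₀ r | φ (x, s) ≤ 0} ⊆ (F s)ᶜ) →
      ∀ s ∈ Ioo t (t + h), {x ∈ Metric.closedBall x₀ r | φ (x, s) < 0} ⊆ (F s)ᶜ

/-- The space-time set `⋃_{t ∈ (0,T)} A_t × {t}` of a family of subsets of `ℝⁿ`. -/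
def spaceTimeSet {n : ℕ} (T : ℝ) (A : ℝ → Set (EuclideanSpace ℝ (Fin n))) :
    Set (EuclideanSpace ℝ (Fin n) × ℝ) :=
  ⋃ t ∈ Ioo 0 T, A t ×ˢ {t}

/-- The function `1_S - 1_{Sᶜ}`. -/
def signIndicator {X : Type*} (S : Set X) (p : X) : ℝ :=
  S.indicator (fun _ => (1 : ℝ)) p - Sᶜ.indicator (fun _ => (1 : ℝ)) p

end

/-! Superflow and supersolution both express comparison with strict smooth subsolutions. If `χ` is a
supersolution but a superlevel set of a test function escapes from `Ω`, subtract from that function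
a penalty increasing in time and maximise over the part of the cylinder outside `Ω`. The initial and
lateral conditions and the penalty make the maximum point interior; the jump of `χ` makes it a local
minimum of `χ - Φ`, where the strict inequality is contradicted.

Conversely, if the supersolution inequality fails at a point outside `Ω`, minimality forces nearby
points where the linear part of `φ` dominates an error `ε d` to lie in `Ω`
(`exists_forall_mem_of_isLocalMin`). Explicit quadratic barriers then meet all the superflow
hypotheses and put the point itself in `Ω`: a shrinking ball when `Dφ = 0`, a slightly bent
half-space when `Dφ ≠ 0`.

Part (ii) is part (i) for complements, with `-α` and `-φ`. -/

/-- Here `limsup` is an `sInf` and `liminf` an `sSup` of sets exchanged by negation; in `ℝ` this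
needs no boundedness. -/
theorem uscEnvelope_neg {X : Type*} [TopologicalSpace X] (f : X → ℝ) (a : X) :
    uscEnvelope (fun x => -f x) a = -lscEnvelope f a := by
  unfold uscEnvelope lscEnvelope
  rw [limsup_eq, liminf_eq, ← Real.sInf_neg]
  congr 1
  ext b
  simp only [mem_ofPred_eq, Set.mem_neg, neg_le]

theorem lscEnvelope_neg {X : Type*} [TopologicalSpace X] (f : X → ℝ) (a : X) :
    lscEnvelope (fun x => -f x) a = -uscEnvelope f a := by
  have h := uscEnvelope_neg (fun x => -f x) a
  simp only [neg_neg] at h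
  rw [h, neg_neg]

section Bounded

variable {X : Type*} {f : X → ℝ} {C : ℝ}

theorem isBoundedUnder_le_of_abs_le (hf : ∀ x, |f x| ≤ C) (l : Filter X) :
    l.IsBoundedUnder (· ≤ ·) f :=
  isBoundedUnder_of ⟨C, fun x => (abs_le.1 (hf x)).2⟩

theorem isBoundedUnder_ge_of_abs_le (hf : ∀ x, |f x| ≤ C) (l : Filter X) :
    l.IsBoundedUnder (· ≥ ·) f :=
  isBoundedUnder_of ⟨-C, fun x => (abs_le.1 (hf x)).1⟩

theorem abs_uscEnvelope_le [TopologicalSpace X] (hf : ∀ x, |f x| ≤ C) (a : X) : |uscEnvelope f a| ≤ C := by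
  rw [abs_le]
  constructor
  · exact le_limsup_of_frequently_le
      (Eventually.frequently (Eventually.of_forall fun x => (abs_le.1 (hf x)).1))
      (isBoundedUnder_le_of_abs_le hf _)
  · exact limsup_le_of_le (isBoundedUnder_ge_of_abs_le hf _).isCoboundedUnder_le
      (Eventually.of_forall fun x => (abs_le.1 (hf x)).2)

/-- Upper semicontinuity of the envelope: a bound on `f` in an open neighbourhood passes to the
envelope at each of its points. -/
theorem eventually_uscEnvelope_le [TopologicalSpace X] (hf : ∀ x, |f x| ≤ C) (a : X) {η : ℝ} (hη : 0 < η) :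
    ∀ᶠ x in 𝓝 a, uscEnvelope f x ≤ uscEnvelope f a + η := by
  have h : ∀ᶠ y in 𝓝 a, f y < uscEnvelope f a + η :=
    eventually_lt_of_limsup_lt (lt_add_of_pos_right _ hη) (isBoundedUnder_le_of_abs_le hf _)
  filter_upwards [h.eventually_nhds] with x hx
  exact limsup_le_of_le (isBoundedUnder_ge_of_abs_le hf _).isCoboundedUnder_le
    (hx.mono fun _ => le_of_lt)

end Bounded

section SignIndicator

variable {X : Type*} {S : Set X} {p : X}

theorem signIndicator_of_mem (h : p ∈ S) : signIndicator S p = 1 := by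
  simp [signIndicator, h]

theorem signIndicator_of_notMem (h : p ∉ S) : signIndicator S p = -1 := by
  simp [signIndicator, h]

theorem abs_signIndicator (S : Set X) (p : X) : |signIndicator S p| ≤ 1 := by
  by_cases h : p ∈ S
  · simp [signIndicator_of_mem h]
  · simp [signIndicator_of_notMem h]

/-- Openness makes `1_S - 1_{Sᶜ}` lower semicontinuous, so the envelope disappears from the
supersolution test. -/
theorem lscEnvelope_signIndicator [TopologicalSpace X] (hS : IsOpen S) :
    lscEnvelope (signIndicator S) = signIndicator S := by
  funext p
  by_cases h : p ∈ S
  · rw [signIndicator_of_mem h]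
    have : signIndicator S =ᶠ[𝓝 p] fun _ => (1 : ℝ) := by
      filter_upwards [hS.mem_nhds h] with q hq using signIndicator_of_mem hq
    exact (liminf_congr this).trans (liminf_const _)
  · rw [signIndicator_of_notMem h]
    apply le_antisymm
    · apply liminf_le_of_frequently_le _ (isBoundedUnder_ge_of_abs_le (abs_signIndicator S) _)
      rw [frequently_iff]
      intro U hU
      exact ⟨p, mem_of_mem_nhds hU, (signIndicator_of_notMem h).le⟩
    · exact le_liminf_of_le (isBoundedUnder_le_of_abs_le (abs_signIndicator S) _).isCoboundedUnder_ge
        (Eventually.of_forall fun q => (abs_le.1 (abs_signIndicator S q)).1)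

end SignIndicator

theorem locallyBoundedOn_signIndicator {X : Type*} [TopologicalSpace X] (S V : Set X) :
    LocallyBoundedOn (signIndicator S) V := fun _ _ =>
  ⟨1, Eventually.of_forall (abs_signIndicator S)⟩

theorem isOpen_openStrip (n : ℕ) (T : ℝ) : IsOpen (openStrip n T) :=
  isOpen_univ.prod isOpen_Ioo

/-! ### Partial derivatives and quadratic barriers -/

section Calculus

variable {n : ℕ} {φ : EuclideanSpace ℝ (Fin n) × ℝ → ℝ} {x : EuclideanSpace ℝ (Fin n)} {t : ℝ}

theorem timeDeriv_of_hasFDerivAt {L : EuclideanSpace ℝ (Fin n) × ℝ →L[ℝ] ℝ}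
    (h : HasFDerivAt φ L (x, t)) : timeDeriv φ x t = L (0, 1) := by
  have h2 : HasDerivAt (fun s : ℝ => (x, s)) ((0 : EuclideanSpace ℝ (Fin n)), (1 : ℝ)) t :=
    (hasDerivAt_const t x).prodMk (hasDerivAt_id t)
  exact (h.comp_hasDerivAt t h2).deriv

theorem inner_spaceGrad_of_hasFDerivAt {L : EuclideanSpace ℝ (Fin n) × ℝ →L[ℝ] ℝ}
    (h : HasFDerivAt φ L (x, t)) (v : EuclideanSpace ℝ (Fin n)) :
    inner ℝ (spaceGrad φ x t) v = L (v, 0) := by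
  have h2 : HasFDerivAt (fun y : EuclideanSpace ℝ (Fin n) => (y, t))
      ((ContinuousLinearMap.id ℝ _).prod 0) x :=
    (hasFDerivAt_id x).prodMk (hasFDerivAt_const t x)
  have h3 := (h.comp x h2).fderiv
  have h4 : fderiv ℝ (fun y => φ (y, t)) x = L.comp ((ContinuousLinearMap.id ℝ _).prod 0) := h3
  rw [spaceGrad, gradient, InnerProductSpace.toDual_symm_apply, h4]
  simp

theorem apply_eq_of_hasFDerivAt {L : EuclideanSpace ℝ (Fin n) × ℝ →L[ℝ] ℝ}
    (h : HasFDerivAt φ L (x, t)) (v : EuclideanSpace ℝ (Fin n)) (τ : ℝ) :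
    L (v, τ) = timeDeriv φ x t * τ + inner ℝ (spaceGrad φ x t) v := by
  rw [inner_spaceGrad_of_hasFDerivAt h, timeDeriv_of_hasFDerivAt h]
  have : ((v, τ) : EuclideanSpace ℝ (Fin n) × ℝ) = τ • (0, 1) + (v, 0) := by
    ext <;> simp
  rw [this, map_add, map_smul, smul_eq_mul, mul_comm]

theorem timeDeriv_neg : timeDeriv (fun p => -φ p) x t = -timeDeriv φ x t := by
  simp [timeDeriv, deriv.fun_neg]

theorem spaceGrad_neg : spaceGrad (fun p => -φ p) x t = -spaceGrad φ x t := by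
  simp [spaceGrad, gradient, fderiv_fun_neg]

theorem timeDeriv_sub_time {g : ℝ → ℝ} (hφ : DifferentiableAt ℝ φ (x, t))
    (hg : DifferentiableAt ℝ g t) :
    timeDeriv (fun p => φ p - g p.2) x t = timeDeriv φ x t - deriv g t := by
  have h2 : DifferentiableAt ℝ (fun s : ℝ => φ (x, s)) t :=
    hφ.comp t ((differentiableAt_const x).prodMk differentiableAt_id)
  exact deriv_fun_sub h2 hg

theorem spaceGrad_sub_time {g : ℝ → ℝ} :
    spaceGrad (fun p => φ p - g p.2) x t = spaceGrad φ x t := by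
  unfold spaceGrad gradient
  dsimp only
  rw [fderiv_sub_const]

/-- The polynomial `c + m (s - t₀) + ⟪p, x - x₀⟫ - k ‖x - x₀‖²`. -/
noncomputable def paraboloid (x₀ : EuclideanSpace ℝ (Fin n)) (t₀ c m k : ℝ)
    (p : EuclideanSpace ℝ (Fin n)) (q : EuclideanSpace ℝ (Fin n) × ℝ) : ℝ :=
  c + m * (q.2 - t₀) + inner ℝ p (q.1 - x₀) - k * ‖q.1 - x₀‖ ^ 2

theorem contDiff_paraboloid (x₀ : EuclideanSpace ℝ (Fin n)) (t₀ c m k : ℝ)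
    (p : EuclideanSpace ℝ (Fin n)) : ContDiff ℝ ∞ (paraboloid x₀ t₀ c m k p) := by
  unfold paraboloid
  have h : ContDiff ℝ ∞ (fun q : EuclideanSpace ℝ (Fin n) × ℝ => q.1 - x₀) := by fun_prop
  exact ((by fun_prop : ContDiff ℝ ∞ (fun q : EuclideanSpace ℝ (Fin n) × ℝ => c + m * (q.2 - t₀))).add
    (contDiff_const.inner ℝ h)).sub (contDiff_const.mul (h.norm_sq ℝ))

theorem timeDeriv_paraboloid (x₀ : EuclideanSpace ℝ (Fin n)) (t₀ c m k : ℝ)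
    (p x : EuclideanSpace ℝ (Fin n)) (s : ℝ) :
    timeDeriv (paraboloid x₀ t₀ c m k p) x s = m := by
  have h : HasDerivAt (fun s : ℝ => paraboloid x₀ t₀ c m k p (x, s)) (m * 1) s := by
    unfold paraboloid
    exact (((((hasDerivAt_id s).sub_const t₀).const_mul m).const_add c).add_const
      (inner ℝ p (x - x₀))).sub_const (k * ‖x - x₀‖ ^ 2)
  simpa [timeDeriv] using h.deriv

theorem spaceGrad_paraboloid (x₀ : EuclideanSpace ℝ (Fin n)) (t₀ c m k : ℝ)
    (p x : EuclideanSpace ℝ (Fin n)) (s : ℝ) :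
    spaceGrad (paraboloid x₀ t₀ c m k p) x s = p - (2 * k) • (x - x₀) := by
  have h0 : HasFDerivAt (fun y : EuclideanSpace ℝ (Fin n) => y - x₀)
    (ContinuousLinearMap.id ℝ _) x := (hasFDerivAt_id x).sub_const x₀
  have h1 := (((innerSL ℝ p).hasFDerivAt.comp x h0).const_add (c + m * (s - t₀))).sub
    (h0.norm_sq.const_mul k)
  apply HasGradientAt.gradient
  rw [hasGradientAt_iff_hasFDerivAt]
  refine h1.congr_fderiv ?_
  ext v
  simp
  ring

end Calculus

/-! ### Supersolutions are superflows; tools for the converse -/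

section Flow

variable {n : ℕ} {T : ℝ} {α : EuclideanSpace ℝ (Fin n) → ℝ}
  {Ω : ℝ → Set (EuclideanSpace ℝ (Fin n))}

theorem mem_spaceTimeSet {x : EuclideanSpace ℝ (Fin n)} {s : ℝ} :
    (x, s) ∈ spaceTimeSet T Ω ↔ s ∈ Ioo 0 T ∧ x ∈ Ω s := by
  simp only [spaceTimeSet, mem_iUnion, mem_prod, mem_singleton_iff, exists_prop]
  constructor
  · rintro ⟨i, hi, hx, rfl⟩
    exact ⟨hi, hx⟩
  · rintro ⟨hs, hx⟩
    exact ⟨s, hs, hx, rfl⟩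

/-- Take `k τ = M / a` and use `u + 1 ≤ exp u`. -/
theorem exists_pos_penalty {a M τ : ℝ} (ha : 0 < a) (hM : 0 < M) (hτ : 0 < τ) :
    ∃ k : ℝ, 0 < k ∧ M < a * Real.exp (k * τ) := by
  refine ⟨M / a / τ, by positivity, ?_⟩
  have h := Real.add_one_le_exp (M / a / τ * τ)
  rw [div_mul_cancel₀ _ hτ.ne'] at h ⊢
  rw [← div_lt_iff₀' ha]
  linarith

theorem isGeneralizedSuperflow_of_isViscositySupersolution
    (hΩ : ∀ t ∈ Ioo 0 T, IsOpen (Ω t)) (hS : IsOpen (spaceTimeSet T Ω))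
    (hsup : IsViscositySupersolution α T (signIndicator (spaceTimeSet T Ω))) :
    IsGeneralizedSuperflow α T Ω := by
  refine ⟨hΩ, fun x₀ t r h ht hr hh htT φ hφ hlt _ _ hinit hlat s hs x hx => ?_⟩
  by_contra hxs
  obtain ⟨hxb, hφx⟩ := hx
  set S := spaceTimeSet T Ω with hSdef
  have hφ1 : ContDiffOn ℝ 1 φ (openStrip n T) :=
    (hφ.mono (prod_mono_right Ioo_subset_Icc_self)).of_le (by norm_cast)
  have hIoo : ∀ σ ∈ Icc t (t + h), σ ∈ Ioo 0 T := fun σ hσ =>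
    ⟨ht.1.trans_le hσ.1, hσ.2.trans_lt htT⟩
  have hcylsub : Metric.closedBall x₀ r ×ˢ Icc t (t + h) ⊆ openStrip n T := fun q hq =>
    ⟨mem_univ _, hIoo _ hq.2⟩
  have hcyl : IsCompact (Metric.closedBall x₀ r ×ˢ Icc t (t + h)) :=
    (isCompact_closedBall x₀ r).prod isCompact_Icc
  have hsI : s ∈ Icc t (t + h) := Ioo_subset_Icc_self hs
  have hcont := hφ1.continuousOn.mono hcylsub
  obtain ⟨qM, -, hM⟩ := hcyl.exists_isMaxOn ⟨(x, s), hxb, hsI⟩ hcont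
  have hMx : φ (x, s) ≤ φ qM := hM (show (x, s) ∈ _ from ⟨hxb, hsI⟩)
  -- The penalty `g` is half of `φ` at time `s`, so `φ - g` stays positive at the bad point, and
  -- exceeds `max φ` at time `t + h`, which excludes a positive maximum there.
  obtain ⟨k, hk, hkM⟩ := exists_pos_penalty (half_pos hφx) (hφx.trans_le hMx)
    (sub_pos.2 hs.2)
  set g : ℝ → ℝ := fun σ => φ (x, s) / 2 * Real.exp (k * (σ - s)) with hg
  have hgC : ContDiff ℝ 1 g := by rw [hg]; fun_prop
  have hgpos : ∀ σ, 0 < g σ := fun σ => mul_pos (half_pos hφx) (Real.exp_pos _)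
  have hgd : ∀ σ, 0 < deriv g σ := by
    intro σ
    have h1 : HasDerivAt g (φ (x, s) / 2 * (Real.exp (k * (σ - s)) * (k * 1))) σ :=
      ((((hasDerivAt_id σ).sub_const s).const_mul k).exp).const_mul _
    rw [h1.deriv]
    have := half_pos hφx
    positivity
  set Φ : EuclideanSpace ℝ (Fin n) × ℝ → ℝ := fun q => φ q - g q.2 with hΦ
  have hΦC : ContDiffOn ℝ 1 Φ (openStrip n T) :=
    hφ1.sub (hgC.comp contDiff_snd).contDiffOn
  have hxK : (x, s) ∈ (Metric.closedBall x₀ r ×ˢ Icc t (t + h)) ∩ Sᶜ :=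
    ⟨⟨hxb, hsI⟩, fun hmem => hxs (mem_spaceTimeSet.1 hmem).2⟩
  obtain ⟨⟨y, σ⟩, ⟨⟨hyb, hσI⟩, hyS⟩, hmax⟩ :=
    (hcyl.inter_right hS.isClosed_compl).exists_isMaxOn ⟨_, hxK⟩
      (hΦC.continuousOn.mono (inter_subset_left.trans hcylsub))
  simp only at hyb hσI
  have hyΩ : y ∉ Ω σ := fun hmem => hyS (mem_spaceTimeSet.2 ⟨hIoo σ hσI, hmem⟩)
  have hΦpos : 0 < Φ (y, σ) := by
    refine lt_of_lt_of_le ?_ (hmax hxK)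
    simp only [hΦ, hg, sub_self, mul_zero, Real.exp_zero]
    linarith
  have hφy : 0 < φ (y, σ) := by
    have := hgpos σ
    simp only [hΦ] at hΦpos
    linarith
  have hσt : t < σ := by
    refine lt_of_le_of_ne hσI.1 ?_
    rintro rfl
    exact hyΩ (hinit ⟨hyb, hφy.le⟩)
  have hσh : σ < t + h := by
    refine lt_of_le_of_ne hσI.2 ?_
    intro hEq
    have h1 : φ (y, σ) ≤ φ qM := hM (show (y, σ) ∈ _ from ⟨hyb, hσI⟩)
    have h2 : φ qM < g σ := by rw [hEq]; exact hkM
    simp only [hΦ] at hΦpos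
    linarith
  have hyball : y ∈ Metric.ball x₀ r := by
    rw [Metric.mem_ball]
    refine lt_of_le_of_ne (Metric.mem_closedBall.1 hyb) fun hEq => ?_
    exact hyΩ (hlat σ hσI ⟨Metric.mem_sphere.2 hEq, hφy.le⟩)
  have hstrip : openStrip n T ∈ 𝓝 (y, σ) :=
    (isOpen_openStrip n T).mem_nhds (hcylsub ⟨hyb, hσI⟩)
  have hmin : IsLocalMin (fun p => lscEnvelope (signIndicator S) p - Φ p) (y, σ) := by
    rw [lscEnvelope_signIndicator hS]
    have hc : ContinuousAt Φ (y, σ) := hΦC.continuousOn.continuousAt hstrip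
    -- Inside `S` the indicator is larger by 2, which absorbs the variation of `Φ`; outside `S`
    -- maximality applies.
    have h1 : ∀ᶠ q in 𝓝 (y, σ), Φ q < Φ (y, σ) + 2 :=
      hc.eventually_lt continuousAt_const (by simp)
    have h2 : Metric.ball x₀ r ×ˢ Ioo t (t + h) ∈ 𝓝 (y, σ) :=
      (Metric.isOpen_ball.prod isOpen_Ioo).mem_nhds ⟨hyball, hσt, hσh⟩
    filter_upwards [h1, h2] with q hq1 hq2
    rw [signIndicator_of_notMem hyS]
    by_cases hqS : q ∈ S
    · rw [signIndicator_of_mem hqS]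
      linarith
    · rw [signIndicator_of_notMem hqS]
      have : Φ q ≤ Φ (y, σ) :=
        hmax ⟨⟨Metric.ball_subset_closedBall hq2.1, Ioo_subset_Icc_self hq2.2⟩, hqS⟩
      linarith
  have hfin := hsup.2 Φ hΦC y σ (hIoo σ hσI) hmin
  have hdφ : DifferentiableAt ℝ φ (y, σ) :=
    (hφ1.contDiffAt hstrip).differentiableAt one_ne_zero
  rw [hΦ, timeDeriv_sub_time hdφ (hgC.differentiable one_ne_zero σ), spaceGrad_sub_time] at hfin
  have := hlt y hyb σ hσI
  have := hgd σ
  linarith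

/-- Near a point `(x₀, t₀)` outside `S` where `1_S - 1_{Sᶜ} - φ` has a local minimum, `S` contains
the points at which the linear part of `φ` dominates the distance to `(x₀, t₀)`. -/
theorem exists_forall_mem_of_isLocalMin {S : Set (EuclideanSpace ℝ (Fin n) × ℝ)}
    {φ : EuclideanSpace ℝ (Fin n) × ℝ → ℝ} {x₀ : EuclideanSpace ℝ (Fin n)} {t₀ : ℝ}
    (hp : (x₀, t₀) ∉ S) (hφ : DifferentiableAt ℝ φ (x₀, t₀))
    (hmin : IsLocalMin (fun p => signIndicator S p - φ p) (x₀, t₀)) {ε : ℝ} (hε : 0 < ε) :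
    ∃ ρ > 0, ∀ x s, ‖x - x₀‖ ≤ ρ → |s - t₀| ≤ ρ → ∀ d, ‖x - x₀‖ ≤ d → |s - t₀| ≤ d →
      ε * d < timeDeriv φ x₀ t₀ * (s - t₀) + inner ℝ (spaceGrad φ x₀ t₀) (x - x₀) →
        (x, s) ∈ S := by
  have h1 := hφ.hasFDerivAt.isLittleO.def hε
  obtain ⟨ρ, hρ, hball⟩ := Metric.nhds_basis_closedBall.eventually_iff.1 (h1.and hmin)
  refine ⟨ρ, hρ, fun x s hx hs d hxd hsd hlt => ?_⟩
  have hmem : (x, s) ∈ Metric.closedBall (x₀, t₀) ρ := by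
    rw [mem_closedBall_iff_norm, Prod.mk_sub_mk, Prod.norm_def]
    exact max_le hx hs
  obtain ⟨hA, hB⟩ := hball hmem
  by_contra hS
  dsimp only at hB
  -- With both points outside `S` the indicators cancel, so `φ` cannot increase and its linear part
  -- is at most `ε d`.
  rw [signIndicator_of_notMem hS, signIndicator_of_notMem hp] at hB
  have hd : ‖(x, s) - (x₀, t₀)‖ ≤ d := by
    rw [Prod.mk_sub_mk, Prod.norm_def]
    exact max_le hxd hsd
  rw [Real.norm_eq_abs, Prod.mk_sub_mk, apply_eq_of_hasFDerivAt hφ.hasFDerivAt] at hA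
  have hA' := (abs_le.1 hA).1
  rw [Prod.mk_sub_mk] at hd
  have := mul_le_mul_of_nonneg_left hd hε.le
  linarith

theorem exists_mem_closedBall_eq_zero {f : EuclideanSpace ℝ (Fin n) → ℝ} (hf : Continuous f)
    {x₀ y z : EuclideanSpace ℝ (Fin n)} {r : ℝ} (hy : y ∈ Metric.closedBall x₀ r)
    (hz : z ∈ Metric.closedBall x₀ r) (hfy : f y ≤ 0) (hfz : 0 ≤ f z) :
    ∃ x ∈ Metric.closedBall x₀ r, f x = 0 :=
  (convex_closedBall x₀ r).isPreconnected.intermediate_value hy hz hf.continuousOn ⟨hfy, hfz⟩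

/-- The time interval is centred at `t₀` because the superflow conclusion holds only at interior
times; `c` is the value of the barrier at `(x₀, t₀)`. -/
theorem IsGeneralizedSuperflow.mem_of_paraboloid (hflow : IsGeneralizedSuperflow α T Ω)
    {x₀ p : EuclideanSpace ℝ (Fin n)} {t₀ r h c m k : ℝ} (hr : 0 < r) (hh : 0 < h)
    (h0 : h < t₀) (hT : t₀ + h < T) (hc : 0 < c)
    (hlt : ∀ x, ‖x - x₀‖ ≤ r → m + uscEnvelope α x * ‖p - (2 * k) • (x - x₀)‖ < 0)
    (hzero : ∀ s, |s - t₀| ≤ h → ∃ x ∈ Metric.closedBall x₀ r, paraboloid x₀ t₀ c m k p (x, s) = 0)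
    (hgrad : ∀ x s, ‖x - x₀‖ ≤ r → |s - t₀| ≤ h → paraboloid x₀ t₀ c m k p (x, s) = 0 →
      p - (2 * k) • (x - x₀) ≠ 0)
    (hinit : ∀ x, ‖x - x₀‖ ≤ r → 0 ≤ paraboloid x₀ t₀ c m k p (x, t₀ - h) → x ∈ Ω (t₀ - h))
    (hlat : ∀ x s, ‖x - x₀‖ = r → |s - t₀| ≤ h → 0 ≤ paraboloid x₀ t₀ c m k p (x, s) → x ∈ Ω s) :
    x₀ ∈ Ω t₀ := by
  have hI : ∀ s ∈ Icc (t₀ - h) (t₀ - h + 2 * h), |s - t₀| ≤ h := fun s hs =>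
    abs_le.2 ⟨by linarith [hs.1], by linarith [hs.2]⟩
  refine hflow.2 x₀ (t₀ - h) r (2 * h) ⟨by linarith, by linarith⟩ hr (by linarith) (by linarith)
    (paraboloid x₀ t₀ c m k p) (contDiff_paraboloid x₀ t₀ c m k p).contDiffOn ?_ ?_ ?_ ?_ ?_
    t₀ ⟨by linarith, by linarith⟩ ⟨Metric.mem_closedBall_self hr.le, ?_⟩
  · intro x hx s _
    rw [timeDeriv_paraboloid, spaceGrad_paraboloid]
    exact hlt x (mem_closedBall_iff_norm.1 hx)
  · exact fun s hs => hzero s (hI s hs)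
  · intro x hx s hs h0
    rw [spaceGrad_paraboloid, norm_ne_zero_iff]
    exact hgrad x s (mem_closedBall_iff_norm.1 hx) (hI s hs) h0
  · exact fun x hx => hinit x (mem_closedBall_iff_norm.1 hx.1) hx.2
  · exact fun s hs x hx => hlat x s (mem_sphere_iff_norm.1 hx.1) (hI s hs) hx.2
  · simpa [paraboloid] using hc

end Flow

/-! ### Superflows are supersolutions -/

section Converse

variable {n : ℕ} {T : ℝ} {α : EuclideanSpace ℝ (Fin n) → ℝ}
  {Ω : ℝ → Set (EuclideanSpace ℝ (Fin n))}

theorem IsGeneralizedSuperflow.mem_of_gradient_eq_zero (hn : 1 ≤ n)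
    (hflow : IsGeneralizedSuperflow α T Ω) {B : ℝ} (hα : ∀ x, |α x| ≤ B)
    {x₀ : EuclideanSpace ℝ (Fin n)} {t₀ a : ℝ} (ht : t₀ ∈ Ioo 0 T) (ha : a < 0)
    (hmem : ∀ ε : ℝ, 0 < ε → ∃ ρ > 0, ∀ x s, ‖x - x₀‖ ≤ ρ → |s - t₀| ≤ ρ →
      ∀ d, ‖x - x₀‖ ≤ d → |s - t₀| ≤ d → ε * d < a * (s - t₀) → x ∈ Ω s) :
    x₀ ∈ Ω t₀ := by
  set C := max B 1 with hCdef
  have hC1 : 1 ≤ C := le_max_right _ _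
  have hC0 : 0 < C := zero_lt_one.trans_le hC1
  have hαC : ∀ x, uscEnvelope α x ≤ C := fun x =>
    (abs_le.1 (abs_uscEnvelope_le (fun y => (hα y).trans (le_max_left B 1)) x)).2
  -- With `h = r / (24 C)` below, `ε r` is half of `-a h`, so the whole ball of radius `r` lies in
  -- `Ω` at time `t₀ - h`.
  obtain ⟨ρ, hρ, hΩ⟩ := hmem (-a / (48 * C)) (div_pos (neg_pos.2 ha) (by positivity))
  obtain ⟨r, hr, hrρ⟩ : ∃ r > 0, r ≤ ρ ∧ r < t₀ ∧ r < T - t₀ := by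
    have h1 : 0 < min ρ (min t₀ (T - t₀)) := lt_min hρ (lt_min ht.1 (sub_pos.2 ht.2))
    refine ⟨min ρ (min t₀ (T - t₀)) / 2, half_pos h1, ?_, ?_, ?_⟩
    · exact (half_lt_self h1).le.trans (min_le_left _ _)
    · exact (half_lt_self h1).trans_le ((min_le_right _ _).trans (min_le_left _ _))
    · exact (half_lt_self h1).trans_le ((min_le_right _ _).trans (min_le_right _ _))
  obtain ⟨hrρ, hrt, hrT⟩ := hrρ
  set h := r / (24 * C) with hh
  have hh0 : 0 < h := by positivity
  have hCh : C * h = r / 24 := by rw [hh]; field_simp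
  have hhr : h ≤ r := by nlinarith
  have hval : ∀ x s, paraboloid x₀ t₀ (r ^ 2 / 3) (-(4 * C * r)) 1 0 (x, s) =
      r ^ 2 / 3 - 4 * C * r * (s - t₀) - ‖x - x₀‖ ^ 2 := by
    intro x s
    simp only [paraboloid, inner_zero_left]
    ring
  -- The squared radius of the positivity ball stays strictly between 0 and `r ^ 2`: the zero set
  -- avoids both the centre, where the gradient vanishes, and the lateral boundary.
  have hb : ∀ s, |s - t₀| ≤ h → 0 < r ^ 2 / 3 - 4 * C * r * (s - t₀) ∧
      r ^ 2 / 3 - 4 * C * r * (s - t₀) < r ^ 2 := by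
    intro s hs
    have h1 : |4 * C * r * (s - t₀)| ≤ r ^ 2 / 6 := by
      rw [abs_mul, abs_of_pos (by positivity : 0 < 4 * C * r)]
      calc 4 * C * r * |s - t₀| ≤ 4 * C * r * h := by gcongr
        _ = 4 * r * (C * h) := by ring
        _ = r ^ 2 / 6 := by rw [hCh]; ring
    have h2 := abs_le.1 h1
    have h3 : 0 < r ^ 2 := by positivity
    constructor <;> linarith
  refine hflow.mem_of_paraboloid (p := 0) (c := r ^ 2 / 3) (m := -(4 * C * r)) (k := 1) hr hh0
    (by linarith) (by linarith) (by positivity) ?_ ?_ ?_ ?_ ?_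
  · intro x hx
    have h1 : ‖(0 : EuclideanSpace ℝ (Fin n)) - (2 * 1 : ℝ) • (x - x₀)‖ ≤ 2 * r := by
      rw [zero_sub, norm_neg, norm_smul]
      norm_num
      exact hx
    have h2 : uscEnvelope α x * ‖(0 : EuclideanSpace ℝ (Fin n)) - (2 * 1 : ℝ) • (x - x₀)‖ ≤
        C * (2 * r) := mul_le_mul (hαC x) h1 (norm_nonneg _) hC0.le
    have : 0 < C * r := by positivity
    linarith
  · intro s hs
    obtain ⟨e, he⟩ : ∃ e : EuclideanSpace ℝ (Fin n), ‖e‖ = r :=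
      ⟨EuclideanSpace.single ⟨0, hn⟩ r, by simp [abs_of_pos hr]⟩
    refine exists_mem_closedBall_eq_zero (y := x₀ + e) (z := x₀)
      ((contDiff_paraboloid x₀ t₀ _ _ 1 0).continuous.comp (by fun_prop))
      (by simp [he]) (Metric.mem_closedBall_self hr.le) ?_ ?_
    · change paraboloid x₀ t₀ _ _ 1 0 (x₀ + e, s) ≤ 0
      rw [hval, add_sub_cancel_left, he]
      linarith [(hb s hs).2]
    · change 0 ≤ paraboloid x₀ t₀ _ _ 1 0 (x₀, s)
      rw [hval, sub_self, norm_zero]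
      linarith [(hb s hs).1]
  · intro x s _ hs h0 hx
    have hx' : x - x₀ = 0 := by simpa using hx
    rw [hval, hx', norm_zero] at h0
    linarith [(hb s hs).1]
  · intro x hx _
    have habs : |t₀ - h - t₀| ≤ r := by
      rw [sub_sub_cancel_left, abs_neg, abs_of_pos hh0]
      exact hhr
    refine hΩ x _ (hx.trans hrρ) (habs.trans hrρ) r hx habs ?_
    have h1 : -a / (48 * C) * r = -a * h / 2 := by
      rw [hh]
      field_simp
      ring
    rw [h1]
    nlinarith
  · intro x s hx hs h0
    rw [hval, hx] at h0
    linarith [(hb s hs).2]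

theorem IsGeneralizedSuperflow.mem_of_gradient_ne_zero
    (hflow : IsGeneralizedSuperflow α T Ω) {B : ℝ} (hα : ∀ x, |α x| ≤ B)
    {x₀ p : EuclideanSpace ℝ (Fin n)} {t₀ a : ℝ} (ht : t₀ ∈ Ioo 0 T) (hp : p ≠ 0)
    (ha : a + uscEnvelope α x₀ * ‖p‖ < 0)
    (hmem : ∀ ε : ℝ, 0 < ε → ∃ ρ > 0, ∀ x s, ‖x - x₀‖ ≤ ρ → |s - t₀| ≤ ρ →
      ∀ d, ‖x - x₀‖ ≤ d → |s - t₀| ≤ d → ε * d < a * (s - t₀) + inner ℝ p (x - x₀) →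
        x ∈ Ω s) :
    x₀ ∈ Ω t₀ := by
  set A := uscEnvelope α x₀ with hA
  set N := ‖p‖ with hN
  have hN0 : 0 < N := norm_pos_iff.2 hp
  -- The factor `3 + 2|A| + N` collects the errors from raising `a` and `A` by `η` and moving the
  -- gradient by at most `2η`; `η ≤ N / 8` keeps the gradient nonzero.
  obtain ⟨η, hη0, hη1, hηN, hηδ⟩ : ∃ η > 0, η ≤ 1 ∧ η ≤ N / 8 ∧
      a + A * N + η * (3 + 2 * |A| + N) < 0 := by
    have hD : 0 < 3 + 2 * |A| + N := by positivity
    have hδ : 0 < -(a + A * N) / (2 * (3 + 2 * |A| + N)) := div_pos (by linarith) (by positivity)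
    refine ⟨min 1 (min (N / 8) (-(a + A * N) / (2 * (3 + 2 * |A| + N)))), by positivity,
      min_le_left _ _, (min_le_right _ _).trans (min_le_left _ _), ?_⟩
    have h1 : min 1 (min (N / 8) (-(a + A * N) / (2 * (3 + 2 * |A| + N)))) * (3 + 2 * |A| + N) ≤
        -(a + A * N) / (2 * (3 + 2 * |A| + N)) * (3 + 2 * |A| + N) :=
      mul_le_mul_of_nonneg_right ((min_le_right _ _).trans (min_le_right _ _)) hD.le
    have h2 : -(a + A * N) / (2 * (3 + 2 * |A| + N)) * (3 + 2 * |A| + N) = -(a + A * N) / 2 := by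
      field_simp
    linarith
  -- With `h = κ r`, the drift in time is at most `N r / 4`, too small to push the zero set off the
  -- segment from `x₀ - e` to `x₀ + e`.
  obtain ⟨κ, hκ0, hκ1, hκN⟩ : ∃ κ > 0, κ ≤ 1 / 3 ∧ (|a| + 1) * κ ≤ N / 4 := by
    refine ⟨min (1 / 3) (N / (4 * (|a| + 1))), by positivity, min_le_left _ _, ?_⟩
    calc (|a| + 1) * min (1 / 3) (N / (4 * (|a| + 1))) ≤ (|a| + 1) * (N / (4 * (|a| + 1))) := by
          gcongr; exact min_le_right _ _
      _ = N / 4 := by field_simp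
  obtain ⟨ρ₀, hρ₀, hΩ⟩ := hmem (η * κ / 4) (by positivity)
  obtain ⟨ρ₁, hρ₁, husc⟩ := Metric.nhds_basis_closedBall.eventually_iff.1
    (eventually_uscEnvelope_le hα x₀ hη0)
  obtain ⟨r, hr, hrρ₀, hrρ₁, hrt, hrT⟩ : ∃ r > 0, r ≤ ρ₀ ∧ r ≤ ρ₁ ∧ r ≤ t₀ ∧ r ≤ T - t₀ := by
    have := ht.1
    have := sub_pos.2 ht.2
    refine ⟨min (min ρ₀ ρ₁) (min t₀ (T - t₀)), by positivity, ?_, ?_, ?_, ?_⟩ <;> simp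
  set h := κ * r with hh
  have hh0 : 0 < h := by positivity
  have hhr : h ≤ r / 3 := by nlinarith
  have haη : |a + η| * h ≤ N * r / 4 := by
    have h1 : |a + η| ≤ |a| + 1 := (abs_add_le a η).trans (by rw [abs_of_pos hη0]; linarith)
    calc |a + η| * h ≤ (|a| + 1) * (κ * r) := by gcongr
      _ = (|a| + 1) * κ * r := by ring
      _ ≤ N / 4 * r := by gcongr
      _ = N * r / 4 := by ring
  have hηh : η * h ≤ N * r / 24 := by
    calc η * h ≤ N / 8 * (r / 3) := by gcongr
      _ = N * r / 24 := by ring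
  have hηr : η * r ≤ N * r / 8 := by
    calc η * r ≤ N / 8 * r := by gcongr
      _ = N * r / 8 := by ring
  have hNr : 0 < N * r := by positivity
  have hε : η * κ / 4 * r = η * h / 4 := by rw [hh]; ring
  have hηh0 : 0 < η * h := by positivity
  have hηhr : η * h ≤ η * r / 3 := by
    calc η * h ≤ η * (r / 3) := by gcongr
      _ = η * r / 3 := by ring
  have htime : ∀ s, |s - t₀| ≤ h → |(a + η) * (s - t₀)| ≤ N * r / 4 := by
    intro s hs
    rw [abs_mul]
    exact (mul_le_mul_of_nonneg_left hs (abs_nonneg _)).trans haη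
  have hgradb : ∀ x, ‖x - x₀‖ ≤ r → ‖(2 * (η / r)) • (x - x₀)‖ ≤ 2 * η := by
    intro x hx
    rw [norm_smul, Real.norm_of_nonneg (by positivity)]
    calc 2 * (η / r) * ‖x - x₀‖ ≤ 2 * (η / r) * r := by gcongr
      _ = 2 * η := by field_simp
  have hsq : η / r * r ^ 2 = η * r := by field_simp
  set e := (r / N) • p with he
  have hen : ‖e‖ = r := by
    rw [he, norm_smul, Real.norm_of_nonneg (by positivity), ← hN]
    field_simp
  have hpe : inner ℝ p e = N * r := by
    rw [he, real_inner_smul_right, real_inner_self_eq_norm_sq, ← hN]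
    field_simp
  refine hflow.mem_of_paraboloid (p := p) (c := η * h / 2) (m := a + η) (k := η / r) hr hh0
    (by linarith) (by linarith) (by positivity) ?_ ?_ ?_ ?_ ?_
  · intro x hx
    have hu : uscEnvelope α x ≤ A + η :=
      husc (mem_closedBall_iff_norm.2 (hx.trans hrρ₁))
    set v := p - (2 * (η / r)) • (x - x₀) with hv
    have h1 : |‖v‖ - N| ≤ 2 * η := by
      refine (abs_norm_sub_norm_le v p).trans ?_
      rw [hv, sub_sub_cancel_left, norm_neg]
      exact hgradb x hx
    have h2 : uscEnvelope α x * ‖v‖ ≤ (A + η) * ‖v‖ :=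
      mul_le_mul_of_nonneg_right hu (norm_nonneg _)
    have h3 : A * (‖v‖ - N) ≤ |A| * (2 * η) := by
      refine (le_abs_self _).trans ?_
      rw [abs_mul]
      gcongr
    have h4 : η * ‖v‖ ≤ η * (N + 2) := by
      have := (abs_le.1 h1).2
      gcongr
      linarith
    linarith
  · intro s hs
    have h1 := abs_le.1 (htime s hs)
    refine exists_mem_closedBall_eq_zero (y := x₀ - e) (z := x₀ + e)
      ((contDiff_paraboloid x₀ t₀ _ _ _ p).continuous.comp (by fun_prop))
      (by simp [hen]) (by simp [hen]) ?_ ?_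
    · change η * h / 2 + (a + η) * (s - t₀) + inner ℝ p (x₀ - e - x₀) -
        η / r * ‖x₀ - e - x₀‖ ^ 2 ≤ 0
      rw [sub_sub_cancel_left, norm_neg, inner_neg_right, hpe, hen, hsq]
      linarith
    · change 0 ≤ η * h / 2 + (a + η) * (s - t₀) + inner ℝ p (x₀ + e - x₀) -
        η / r * ‖x₀ + e - x₀‖ ^ 2
      rw [add_sub_cancel_left, hpe, hen, hsq]
      linarith
  · intro x s hx _ _ h0
    have h1 := hgradb x hx
    rw [← sub_eq_zero.1 h0] at h1
    linarith
  · intro x hx h0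
    have habs : |t₀ - h - t₀| ≤ r := by
      rw [sub_sub_cancel_left, abs_neg, abs_of_pos hh0]
      linarith
    refine hΩ x _ (hx.trans hrρ₀) (habs.trans hrρ₀) r hx habs ?_
    -- At time `t₀ - h` the extra slope `η` costs `η h` while `c` returns half of it, so the linear
    -- part is at least `η h / 2`, above `ε r = η h / 4`.
    have h1 : 0 ≤ η / r * ‖x - x₀‖ ^ 2 := by positivity
    simp only [paraboloid] at h0
    rw [hε]
    linarith
  · intro x s hx hs h0
    have hsr : |s - t₀| ≤ r := by linarith
    refine hΩ x s (hx.le.trans hrρ₀) (hsr.trans hrρ₀) r hx.le hsr ?_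
    simp only [paraboloid] at h0
    rw [hx, hsq] at h0
    -- On the sphere the bending term `η r ≥ 3 η h` outweighs `c` and the extra slope.
    have h1 : η * (s - t₀) ≤ η * h := mul_le_mul_of_nonneg_left ((abs_le.1 hs).2) hη0.le
    rw [hε]
    linarith

theorem isViscositySupersolution_of_isGeneralizedSuperflow (hn : 1 ≤ n)
    (hα : ∃ C : ℝ, ∀ x, |α x| ≤ C) (hS : IsOpen (spaceTimeSet T Ω))
    (hflow : IsGeneralizedSuperflow α T Ω) :
    IsViscositySupersolution α T (signIndicator (spaceTimeSet T Ω)) := by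
  refine ⟨locallyBoundedOn_signIndicator _ _, fun φ hφ x t ht hmin => ?_⟩
  obtain ⟨C, hC⟩ := hα
  rw [lscEnvelope_signIndicator hS] at hmin
  have hd : DifferentiableAt ℝ φ (x, t) :=
    (hφ.contDiffAt ((isOpen_openStrip n T).mem_nhds ⟨mem_univ _, ht⟩)).differentiableAt
      one_ne_zero
  by_cases hp : (x, t) ∈ spaceTimeSet T Ω
  · have hmax : IsLocalMax φ (x, t) := by
      filter_upwards [hmin, hS.mem_nhds hp] with q hq hqS
      rw [signIndicator_of_mem hqS, signIndicator_of_mem hp] at hq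
      linarith
    have h0 := hmax.fderiv_eq_zero
    have h1 : timeDeriv φ x t = 0 := by
      rw [timeDeriv_of_hasFDerivAt hd.hasFDerivAt, h0, zero_apply]
    have h2 : spaceGrad φ x t = 0 := by
      refine ext_inner_right ℝ fun v => ?_
      rw [inner_spaceGrad_of_hasFDerivAt hd.hasFDerivAt, h0, zero_apply,
        inner_zero_left]
    simp [h1, h2]
  · by_contra! hlt
    have hx : x ∉ Ω t := fun h => hp (mem_spaceTimeSet.2 ⟨ht, h⟩)
    have key : ∀ ε : ℝ, 0 < ε → ∃ ρ > 0, ∀ y s, ‖y - x‖ ≤ ρ → |s - t| ≤ ρ →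
        ∀ d, ‖y - x‖ ≤ d → |s - t| ≤ d →
          ε * d < timeDeriv φ x t * (s - t) + inner ℝ (spaceGrad φ x t) (y - x) → y ∈ Ω s := by
      intro ε hε
      obtain ⟨ρ, hρ, h⟩ := exists_forall_mem_of_isLocalMin hp hd hmin hε
      exact ⟨ρ, hρ, fun y s h1 h2 d h3 h4 h5 => (mem_spaceTimeSet.1 (h y s h1 h2 d h3 h4 h5)).2⟩
    by_cases hg : spaceGrad φ x t = 0
    · rw [hg, norm_zero, mul_zero, add_zero] at hlt
      simp only [hg, inner_zero_left, add_zero] at key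
      exact hx (hflow.mem_of_gradient_eq_zero hn hC ht hlt key)
    · exact hx (hflow.mem_of_gradient_ne_zero hC ht hg hlt key)

end Converse

/-! ### Duality between sub- and superflows -/

section Duality

variable {n : ℕ} {T : ℝ} {α : EuclideanSpace ℝ (Fin n) → ℝ}

theorem isGeneralizedSubflow_iff {F : ℝ → Set (EuclideanSpace ℝ (Fin n))} :
    IsGeneralizedSubflow α T F ↔
      IsGeneralizedSuperflow (fun x => -α x) T (fun t => (F t)ᶜ) := by
  unfold IsGeneralizedSubflow IsGeneralizedSuperflow
  simp only [isOpen_compl_iff, uscEnvelope_neg]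
  refine and_congr_right fun _ => ?_
  constructor
  · intro H x₀ t r h ht hr hh hT φ hφ h1 h2 h3 h4 h5 s hs
    have := H x₀ t r h ht hr hh hT (fun p => -φ p) hφ.neg
    simp only [timeDeriv_neg, spaceGrad_neg, norm_neg, neg_eq_zero, neg_nonpos,
      neg_neg_iff_pos] at this
    refine this (fun x hx s hs => ?_) h2 h3 h4 h5 s hs
    linarith [h1 x hx s hs]
  · intro H x₀ t r h ht hr hh hT φ hφ h1 h2 h3 h4 h5 s hs
    have := H x₀ t r h ht hr hh hT (fun p => -φ p) hφ.neg
    simp only [timeDeriv_neg, spaceGrad_neg, norm_neg, neg_eq_zero, neg_nonneg,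
      neg_pos] at this
    refine this (fun x hx s hs => ?_) h2 h3 h4 h5 s hs
    linarith [h1 x hx s hs]

theorem isViscositySubsolution_iff {u : EuclideanSpace ℝ (Fin n) × ℝ → ℝ} :
    IsViscositySubsolution α T u ↔
      IsViscositySupersolution (fun x => -α x) T (fun p => -u p) := by
  unfold IsViscositySubsolution IsViscositySupersolution LocallyBoundedOn
  simp only [abs_neg, uscEnvelope_neg, lscEnvelope_neg]
  refine and_congr_right fun _ => ?_
  constructor
  · intro H φ hφ x t ht hmin
    have hmax := hmin.neg
    have := H (fun p => -φ p) hφ.neg x t ht 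
      (hmax.congr (Eventually.of_forall fun p => by dsimp only; ring))
    rw [timeDeriv_neg, spaceGrad_neg, norm_neg] at this
    linarith
  · intro H φ hφ x t ht hmax
    have hmin := hmax.neg
    have := H (fun p => -φ p) hφ.neg x t ht 
      (hmin.congr (Eventually.of_forall fun p => by dsimp only; ring))
    rw [timeDeriv_neg, spaceGrad_neg, norm_neg] at this
    linarith

/-- Needed because `1_S - 1_{Sᶜ}` for the complementary family equals the negated indicator only on
the strip; off it both space-time sets are empty. Envelopes are local and the strip is open. -/
theorem IsViscositySupersolution.congr {u v : EuclideanSpace ℝ (Fin n) × ℝ → ℝ}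
    (hu : IsViscositySupersolution α T u) (huv : EqOn u v (openStrip n T)) :
    IsViscositySupersolution α T v := by
  have hev : ∀ p ∈ openStrip n T, u =ᶠ[𝓝 p] v := fun p hp =>
    huv.eventuallyEq_of_mem ((isOpen_openStrip n T).mem_nhds hp)
  refine ⟨fun p hp => ?_, fun φ hφ x t ht hmin => hu.2 φ hφ x t ht ?_⟩
  · obtain ⟨C, hC⟩ := hu.1 p hp
    exact ⟨C, by filter_upwards [hC, hev p hp] with q h1 h2 using h2 ▸ h1⟩
  · have hp : (x, t) ∈ openStrip n T := ⟨mem_univ _, ht⟩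
    refine hmin.congr ?_
    filter_upwards [(isOpen_openStrip n T).mem_nhds hp] with q hq
    unfold lscEnvelope
    rw [liminf_congr (hev q hq)]

theorem signIndicator_spaceTimeSet_compl (F : ℝ → Set (EuclideanSpace ℝ (Fin n))) :
    EqOn (signIndicator (spaceTimeSet T fun t => (F t)ᶜ))
      (fun p => -signIndicator (spaceTimeSet T F) p) (openStrip n T) := by
  rintro ⟨x, t⟩ ⟨-, ht⟩
  have ht' : t ∈ Ioo 0 T := ht
  by_cases h : x ∈ F t
  · simp only
    rw [signIndicator_of_mem (mem_spaceTimeSet.2 ⟨ht', h⟩), signIndicator_of_notMem]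
    exact fun hc => (mem_spaceTimeSet.1 hc).2 h
  · simp only
    rw [signIndicator_of_mem (mem_spaceTimeSet.2 ⟨ht', h⟩), signIndicator_of_notMem, neg_neg]
    exact fun hc => h (mem_spaceTimeSet.1 hc).2

end Duality

theorem isGeneralizedSuperflow_iff {n : ℕ} (hn : 1 ≤ n) {T : ℝ}
    {α : EuclideanSpace ℝ (Fin n) → ℝ} (hα : ∃ C : ℝ, ∀ x, |α x| ≤ C)
    {Ω : ℝ → Set (EuclideanSpace ℝ (Fin n))} (hΩ : ∀ t ∈ Ioo 0 T, IsOpen (Ω t))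
    (hS : IsOpen (spaceTimeSet T Ω)) :
    IsGeneralizedSuperflow α T Ω ↔
      IsViscositySupersolution α T (signIndicator (spaceTimeSet T Ω)) :=
  ⟨isViscositySupersolution_of_isGeneralizedSuperflow hn hα hS,
    isGeneralizedSuperflow_of_isViscositySupersolution hΩ hS⟩

theorem theorem2p3 (n : ℕ) (hn : 1 ≤ n) (T : ℝ) (hT : 0 < T)
    (α : EuclideanSpace ℝ (Fin n) → ℝ) (hα : ∃ C : ℝ, ∀ x, |α x| ≤ C) :
    (∀ Ω : ℝ → Set (EuclideanSpace ℝ (Fin n)),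
      (∀ t ∈ Ioo 0 T, IsOpen (Ω t)) →
      (∃ U, IsOpen U ∧ spaceTimeSet T Ω = U ∩ openStrip n T) →
      (IsGeneralizedSuperflow α T Ω ↔
        IsViscositySupersolution α T (signIndicator (spaceTimeSet T Ω)))) ∧
    (∀ F : ℝ → Set (EuclideanSpace ℝ (Fin n)),
      (∀ t ∈ Ioo 0 T, IsClosed (F t)) →
      (∃ K, IsClosed K ∧ spaceTimeSet T F = K ∩ openStrip n T) →
      (IsGeneralizedSubflow α T F ↔
        IsViscositySubsolution α T (signIndicator (spaceTimeSet T F)))) := by 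
  refine ⟨fun Ω hΩ ⟨U, hU, hUS⟩ => ?_, fun F hF ⟨K, hK, hKS⟩ => ?_⟩
  · exact isGeneralizedSuperflow_iff hn hα hΩ (hUS ▸ hU.inter (isOpen_openStrip n T))
  · have hS : spaceTimeSet T (fun t => (F t)ᶜ) = Kᶜ ∩ openStrip n T := by
      ext ⟨x, t⟩
      have h := Set.ext_iff.1 hKS (x, t)
      rw [mem_spaceTimeSet] at h ⊢
      simp only [openStrip, mem_inter_iff, mem_compl_iff, mem_prod, mem_univ, true_and] at h ⊢
      tauto
    have hα' : ∃ C : ℝ, ∀ x, |-α x| ≤ C := by simpa only [abs_neg] using hα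
    rw [isGeneralizedSubflow_iff, isViscositySubsolution_iff,
      isGeneralizedSuperflow_iff hn hα' (fun t ht => (hF t ht).isOpen_compl)
        (hS ▸ hK.isOpen_compl.inter (isOpen_openStrip n T))]
    exact ⟨fun h => h.congr (signIndicator_spaceTimeSet_compl F),
      fun h => h.congr (signIndicator_spaceTimeSet_compl F).symm⟩
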